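/- Let $A$ be a finitely generated (commutative) $\mathbb{R}$-algebra all of whose local rings are regular, that is, let $X = \mathrm{Spec}\, A$ be a smooth affine algebraic variety over $\mathbb{R}$. Assume that $X$ has no imaginary connected components, meaning that every connected component of $X$ contains at least one rational point. Then the set $X(\mathbb{R})$ of rational points of $X$, i.e. of the points $\ker\varphi \in X$ for $\mathbb{R}$-algebra homomorphisms $\varphi\colon A \to \mathbb{R}$, is Zariski dense in $X$. -/

import Mathlib

/-- The set `X(k)` of rational points of the affine `k`-scheme `X = Spec A`, as a subset of `X`:
a `k`-algebra homomorphism `φ : A → k` corresponds to the point `ker φ` of `Spec A`. -/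
def rationalPoints (k A : Type*) [Field k] [CommRing A] [Algebra k A] :
    Set (PrimeSpectrum A) :=
  Set.range fun φ : A →ₐ[k] k => (⟨RingHom.ker φ, RingHom.ker_isPrime φ⟩ : PrimeSpectrum A)

/-- `X = Spec A`, for an `ℝ`-algebra `A`, has no imaginary connected components: every connected
component of `X` (in the Zariski topology) contains at least one rational point. -/
def NoImaginaryComponents (A : Type*) [CommRing A] [Algebra ℝ A] : Prop :=
  ∀ x : PrimeSpectrum A, (connectedComponent x ∩ rationalPoints ℝ A).Nonempty

/-! Density means that a function `f` not vanishing at some point `x` of `X` is nonzero at some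
rational point. Regular local rings are domains, so the locus where the germ of `f` vanishes is
clopen, and `f` has a nonzero germ at a rational point `y` in the component of `x`. Near `y`, a
regular system of parameters defines an unramified map to affine `d`-space, presenting `A_g` as a
quotient of a standard étale algebra `P.Ring`. Both local rings have dimension `d` and that of
`P.Ring` is a domain, so the kernel vanishes near `y`. There a lift of `f` divides a nonzero
polynomial `h` in the coordinates. By the intermediate value theorem, the real points of `P.Ring`
near `y` cover a neighbourhood of the origin, so one of them avoids `h = 0`; there `f` is nonzero
(`exists_algHom_real_ne_zero`). -/

open IsLocalRing Topology

/-! ### Regular local rings are domains -/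

/-- A Noetherian local ring whose maximal ideal is generated by at most `dim R` elements is a
domain. -/
theorem isDomain_of_maximalIdeal_eq_span {n : ℕ} {R : Type*} [CommRing R] [IsLocalRing R]
    [IsNoetherianRing R] (s : Fin n → R) (hs : maximalIdeal R = Ideal.span (Set.range s))
    (hn : (n : WithBot ℕ∞) ≤ ringKrullDim R) : IsDomain R := by
  induction n generalizing R with
  | zero =>
    have : IsField R := by
      rw [isField_iff_maximalIdeal_eq, hs]
      simp
    exact this.isDomain
  | succ n ih =>
    have hpos : (0 : WithBot ℕ∞) < ringKrullDim R :=
      lt_of_lt_of_le (by exact_mod_cast n.succ_pos) hn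
    have hmin : ∀ p ∈ minimalPrimes R, ¬ maximalIdeal R ≤ p := by
      intro p hp hle
      have hpp : p.IsPrime := hp.1.1
      obtain rfl : p = maximalIdeal R := le_antisymm (le_maximalIdeal hpp.ne_top) hle
      rw [← maximalIdeal_height_eq_ringKrullDim, Ideal.height_eq_zero_iff.mpr hp] at hpos
      exact lt_irrefl _ hpos
    have hsq : ¬ maximalIdeal R ≤ maximalIdeal R ^ 2 := by
      intro hle
      have h0 : maximalIdeal R = ⊥ := by
        refine Submodule.eq_bot_of_le_smul_of_le_jacobson_bot (maximalIdeal R) _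
          (IsNoetherian.noetherian _) ?_ (maximalIdeal_le_jacobson _)
        rwa [smul_eq_mul, ← pow_two]
      obtain ⟨p, hp, -⟩ := Ideal.exists_minimalPrimes_le (bot_le : ⊥ ≤ maximalIdeal R)
      exact hmin p hp (h0 ▸ bot_le)
    -- Prime avoidance, which tolerates the possibly non-prime ideal `maximalIdeal R ^ 2`.
    obtain ⟨x, hxm, hx2, hxp⟩ : ∃ x ∈ maximalIdeal R, x ∉ maximalIdeal R ^ 2 ∧
        ∀ p ∈ minimalPrimes R, x ∉ p := by
      by_contra! hcon
      have hfin := (minimalPrimes.finite_of_isNoetherianRing R).insert (maximalIdeal R ^ 2)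
      have := (Ideal.subset_union_prime (s := hfin.toFinset) (f := id) (I := maximalIdeal R)
        (maximalIdeal R ^ 2) (maximalIdeal R ^ 2) (by
          intro i hi h _
          simp only [Set.Finite.mem_toFinset, Set.mem_insert_iff, h, false_or] at hi
          exact hi.1.1)).mp (by
          intro y hy
          simp only [Set.mem_iUnion]
          by_cases hy2 : y ∈ maximalIdeal R ^ 2
          · exact ⟨_, by simp, hy2⟩
          · obtain ⟨p, hp, hyp⟩ := hcon y hy hy2
            exact ⟨p, by simp [hp], hyp⟩)
      obtain ⟨i, hi, hle⟩ := this
      simp only [Set.Finite.mem_toFinset, Set.mem_insert_iff] at hi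
      rcases hi with rfl | hi
      · exact hsq hle
      · exact hmin i hi hle
    obtain ⟨a, ha⟩ : ∃ a : Fin (n + 1) → R, ∑ i, a i * s i = x := by
      rw [hs] at hxm
      exact (Ideal.mem_span_range_iff_exists_fun).mp hxm
    -- As `x` is not in the square, it can replace some generator `s j`; the other `n` generate the
    -- maximal ideal modulo `x`.
    obtain ⟨j, hj⟩ : ∃ j, IsUnit (a j) := by
      by_contra! hcon
      refine hx2 (ha ▸ Ideal.sum_mem _ fun i _ => ?_)
      rw [pow_two]
      exact Ideal.mul_mem_mul ((mem_maximalIdeal _).mpr (hcon i))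
        (hs ▸ Ideal.subset_span ⟨i, rfl⟩)
    have hxtop : Ideal.span {x} ≠ ⊤ := fun h =>
      (maximalIdeal.isMaximal R).ne_top (top_le_iff.mp
        (h ▸ (Ideal.span_singleton_le_iff_mem _).mpr hxm))
    have : Nontrivial (R ⧸ Ideal.span {x}) := Ideal.Quotient.nontrivial_iff.mpr hxtop
    have : IsLocalRing (R ⧸ Ideal.span {x}) :=
      .of_surjective' (Ideal.Quotient.mk _) Ideal.Quotient.mk_surjective
    have hdom : IsDomain (R ⧸ Ideal.span {x}) := by
      refine ih (fun i => Ideal.Quotient.mk _ (s (j.succAbove i))) ?_ ?_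
      · have hmap : maximalIdeal (R ⧸ Ideal.span {x}) =
            (maximalIdeal R).map (Ideal.Quotient.mk (Ideal.span {x})) := by
          refine (IsLocalRing.eq_maximalIdeal ?_).symm
          refine (Ideal.map_eq_top_or_isMaximal_of_surjective _ Ideal.Quotient.mk_surjective
            (maximalIdeal.isMaximal R)).resolve_left fun h => ?_
          have := congr_arg (Ideal.comap (Ideal.Quotient.mk (Ideal.span {x}))) h
          rw [Ideal.comap_map_of_surjective _ Ideal.Quotient.mk_surjective, Ideal.comap_top,
            ← RingHom.ker_eq_comap_bot, Ideal.mk_ker, sup_eq_left.mpr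
              ((Ideal.span_singleton_le_iff_mem _).mpr hxm)] at this
          exact (maximalIdeal.isMaximal R).ne_top this
        rw [hmap, hs, Ideal.map_span]
        apply le_antisymm
        · rw [Ideal.span_le]
          rintro _ ⟨_, ⟨i, rfl⟩, rfl⟩
          rcases Fin.eq_self_or_eq_succAbove j i with rfl | ⟨k, rfl⟩
          · have h0 : (Ideal.Quotient.mk (Ideal.span {x})) x = 0 :=
              Ideal.Quotient.eq_zero_iff_mem.mpr (Ideal.mem_span_singleton_self x)
            apply_fun Ideal.Quotient.mk (Ideal.span {x}) at ha
            rw [h0, Fin.sum_univ_succAbove _ i, map_add, map_mul, map_sum] at ha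
            have hu := hj.map (Ideal.Quotient.mk (Ideal.span {x}))
            refine (Ideal.unit_mul_mem_iff_mem _ hu).mp ?_
            rw [eq_neg_of_add_eq_zero_left ha]
            refine Ideal.neg_mem_iff _ |>.mpr (Ideal.sum_mem _ fun k _ => ?_)
            rw [map_mul]
            exact Ideal.mul_mem_left _ _ (Ideal.subset_span ⟨k, rfl⟩)
          · exact Ideal.subset_span ⟨k, rfl⟩
        · rw [Ideal.span_le]
          rintro _ ⟨k, rfl⟩
          exact Ideal.subset_span ⟨_, ⟨_, rfl⟩, rfl⟩
      · have h := ringKrullDim_le_ringKrullDim_quotient_add_card {x}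
          (by simpa [IsLocalRing.ringJacobson_eq_maximalIdeal] using hxm)
        rw [Finset.coe_singleton, Finset.card_singleton, Nat.cast_one] at h
        have h' := hn.trans h
        rw [Nat.cast_add, Nat.cast_one] at h'
        exact ENat.WithBot.add_le_add_one_right_iff.mp h'
    have hxprime : (Ideal.span {x}).IsPrime := (Ideal.Quotient.isDomain_iff_prime _).mp hdom
    obtain ⟨q, hq, hqx⟩ := Ideal.exists_minimalPrimes_le (bot_le : ⊥ ≤ Ideal.span {x})
    have hqp : q.IsPrime := hq.1.1
    -- Since `q ≤ (x)` and `x ∉ q`, primality gives `q = x q`, and Nakayama applies.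
    have hq0 : q = ⊥ := by
      refine Submodule.eq_bot_of_le_smul_of_le_jacobson_bot (maximalIdeal R) _
          (IsNoetherian.noetherian _) ?_ (maximalIdeal_le_jacobson _)
      intro z hz
      obtain ⟨w, rfl⟩ := Ideal.mem_span_singleton'.mp (hqx hz)
      rw [mul_comm, smul_eq_mul]
      exact Ideal.mul_mem_mul hxm ((hqp.mem_or_mem hz).resolve_right (hxp q hq))
    subst hq0
    exact IsDomain.of_bot_isPrime R

theorem IsRegularLocalRing.exists_maximalIdeal_eq_span (R : Type*) [CommRing R]
    [IsRegularLocalRing R] : ∃ (n : ℕ) (s : Fin n → R),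
      maximalIdeal R = Ideal.span (Set.range s) ∧ (n : WithBot ℕ∞) = ringKrullDim R := by
  obtain ⟨t, ht, hspan⟩ := Submodule.FG.exists_span_finset_card_eq_spanFinrank
    (IsNoetherian.noetherian (maximalIdeal R))
  refine ⟨t.card, fun i => t.equivFin.symm i, ?_, ?_⟩
  · rw [← hspan]
    congr 1
    ext y
    simp only [Set.mem_range, Finset.mem_coe]
    exact ⟨fun hy => ⟨t.equivFin ⟨y, hy⟩, by simp⟩, by rintro ⟨i, rfl⟩; simp⟩
  · rw [← (isRegularLocalRing_iff R).mp inferInstance, ht]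

theorem IsRegularLocalRing.isDomain (R : Type*) [CommRing R] [IsRegularLocalRing R] :
    IsDomain R := by
  obtain ⟨n, s, hs, hn⟩ := IsRegularLocalRing.exists_maximalIdeal_eq_span R
  exact isDomain_of_maximalIdeal_eq_span s hs hn.le

/-! ### Vanishing of germs on a regular ring -/

theorem exists_notMem_mul_eq_zero_of_localization_isDomain {A : Type*} [CommRing A]
    (p : Ideal A) [p.IsPrime] [IsDomain (Localization.AtPrime p)] {f z : A}
    (hf : algebraMap A (Localization.AtPrime p) f ≠ 0) (hz : z * f = 0) :
    ∃ c ∉ p, c * z = 0 := by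
  have h : algebraMap A (Localization.AtPrime p) z = 0 := by
    have := congr_arg (algebraMap A (Localization.AtPrime p)) hz
    rw [map_mul, map_zero] at this
    exact (mul_eq_zero.mp this).resolve_right hf
  obtain ⟨⟨c, hc⟩, h⟩ := (IsLocalization.map_eq_zero_iff p.primeCompl _ _).mp h
  exact ⟨c, hc, h⟩

/-- If every element of a finitely generated ideal is killed by an element outside of `p`,
then the whole ideal is killed by a single element outside of `p`. -/
theorem Ideal.FG.exists_notMem_forall_mul_eq_zero {A : Type*} [CommRing A]
    {I p : Ideal A} (hI : I.FG) (hp : p.IsPrime) (h : ∀ z ∈ I, ∃ c ∉ p, c * z = 0) :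
    ∃ c ∉ p, ∀ z ∈ I, c * z = 0 := by
  classical
  obtain ⟨s, rfl⟩ := hI
  choose! c hc hcz using h
  refine ⟨∏ i ∈ s, c i, ?_, fun z hz => ?_⟩
  · rw [hp.prod_mem_iff]
    rintro ⟨i, hi, h⟩
    exact hc i (Ideal.subset_span hi) h
  · induction hz using Submodule.span_induction with
    | mem z hz =>
      rw [← Finset.prod_erase_mul s c hz, mul_assoc, hcz z (Ideal.subset_span hz), mul_zero]
    | zero => simp
    | add z w _ _ hz hw => rw [mul_add, hz, hw, add_zero]
    | smul a z _ hz => rw [smul_eq_mul, mul_left_comm, hz, mul_zero]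

open PrimeSpectrum in
/-- On a regular ring, the set of points where the germ of a given function vanishes is clopen. -/
theorem IsRegularRing.isClopen_setOf_algebraMap_eq_zero {A : Type*} [CommRing A]
    [IsRegularRing A] (f : A) :
    IsClopen {p : PrimeSpectrum A | algebraMap A (Localization.AtPrime p.asIdeal) f = 0} := by
  refine ⟨isOpen_compl_iff.mp ?_, ?_⟩ <;> rw [isOpen_iff_mem_nhds]
  · intro p hp
    have := IsRegularLocalRing.isDomain (Localization.AtPrime p.asIdeal)
    -- One `c ∉ p` kills the whole annihilator of `f`, so no germ of `f` vanishes on `basicOpen c`.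
    obtain ⟨c, hc, hcz⟩ := Ideal.FG.exists_notMem_forall_mul_eq_zero
      (I := LinearMap.ker (LinearMap.mulRight A f)) (IsNoetherian.noetherian _) p.isPrime
      fun z hz => exists_notMem_mul_eq_zero_of_localization_isDomain p.asIdeal hp hz
    filter_upwards [(basicOpen c).isOpen.mem_nhds hc] with q hq hq0
    obtain ⟨⟨b, hb⟩, h⟩ := (IsLocalization.map_eq_zero_iff q.asIdeal.primeCompl _ _).mp hq0
    have := hcz b h
    exact (q.isPrime.mul_notMem hq hb) (this ▸ q.asIdeal.zero_mem)
  · intro p hp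
    obtain ⟨⟨b, hb⟩, h⟩ := (IsLocalization.map_eq_zero_iff p.asIdeal.primeCompl _ _).mp hp
    filter_upwards [(basicOpen b).isOpen.mem_nhds hb] with q hq
    exact (IsLocalization.map_eq_zero_iff q.asIdeal.primeCompl _ _).mpr ⟨⟨b, hq⟩, h⟩

/-! ### Real points of standard étale algebras -/

namespace StandardEtalePair

open MvPolynomial Filter

theorem continuous_eval₂_eval {σ : Type*} (f : Polynomial (MvPolynomial σ ℝ)) :
    Continuous fun x : (σ → ℝ) × ℝ => f.eval₂ (eval x.1) x.2 := by
  simp only [Polynomial.eval₂_eq_sum_range]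
  refine continuous_finsetSum _ fun i _ => ?_
  exact ((f.coeff i).continuous_eval.comp continuous_fst).mul (continuous_snd.pow i)

/-- A real polynomial changes sign at a simple root. -/
theorem _root_.Polynomial.exists_sign_change {q : Polynomial ℝ} {t₀ : ℝ} (h0 : q.eval t₀ = 0)
    (h1 : q.derivative.eval t₀ ≠ 0) {ε : ℝ} (hε : 0 < ε) :
    ∃ δ > 0, δ < ε ∧ q.eval (t₀ - δ) * q.eval (t₀ + δ) < 0 := by
  -- Here `q = (X - t₀) r` with `r(t₀) = q'(t₀) ≠ 0`, so `r` has constant sign near `t₀`.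
  obtain ⟨r, rfl⟩ := Polynomial.dvd_iff_isRoot.mpr h0
  have hr : r.eval t₀ ≠ 0 := by simpa using h1
  have hcont : ContinuousAt (fun t => r.eval t * r.eval t₀) t₀ :=
    (r.continuous.mul continuous_const).continuousAt
  obtain ⟨η, hη, h⟩ := Metric.eventually_nhds_iff.mp
    (hcont.eventually (lt_mem_nhds (mul_self_pos.mpr hr)))
  obtain ⟨δ, hδ, hδ'⟩ := exists_between (lt_min hε hη)
  rw [lt_min_iff] at hδ'
  refine ⟨δ, hδ, hδ'.1, ?_⟩
  have h1 := h (y := t₀ - δ) (by simp [abs_of_pos hδ, hδ'.2])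
  have h2 := h (y := t₀ + δ) (by simp [abs_of_pos hδ, hδ'.2])
  have h3 : 0 < r.eval (t₀ - δ) * r.eval (t₀ + δ) := by
    have := mul_pos h1 h2
    have h4 : 0 < (r.eval (t₀ - δ) * r.eval (t₀ + δ)) * (r.eval t₀ * r.eval t₀) := by
      nlinarith
    exact pos_of_mul_pos_left h4 (mul_self_nonneg _)
  simp only [Polynomial.eval_mul, Polynomial.eval_sub, Polynomial.eval_X, Polynomial.eval_C]
  nlinarith [mul_pos (mul_pos hδ hδ) h3]

variable {σ : Type*} [Fintype σ]

/-- The zeros of a polynomial near a zero which is simple in the last variable surject onto a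
neighbourhood in the space of the remaining variables. -/
theorem eventually_exists_eval₂_eq_zero {f : Polynomial (MvPolynomial σ ℝ)} {a : σ → ℝ} {t₀ : ℝ}
    (h0 : f.eval₂ (eval a) t₀ = 0) (h1 : f.derivative.eval₂ (eval a) t₀ ≠ 0)
    {U : Set ((σ → ℝ) × ℝ)} (hU : U ∈ 𝓝 (a, t₀)) :
    ∀ᶠ b in 𝓝 a, ∃ t, (b, t) ∈ U ∧ f.eval₂ (eval b) t = 0 := by
  obtain ⟨ε, hε, hball⟩ := Metric.mem_nhds_iff.mp hU
  obtain ⟨δ, hδ, hδε, hsign⟩ := Polynomial.exists_sign_change (q := f.map (eval a)) (t₀ := t₀)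
    (by rwa [Polynomial.eval_map]) (by rwa [Polynomial.derivative_map, Polynomial.eval_map]) hε
  simp only [Polynomial.eval_map] at hsign
  have hc (t : ℝ) : Continuous fun b : σ → ℝ => f.eval₂ (eval b) t :=
    (continuous_eval₂_eval f).comp (continuous_id.prodMk continuous_const)
  -- The sign change at `t₀ ± δ` persists for `b` near `a`, so the intermediate value theorem gives
  -- a root in between.
  have hev := ((hc (t₀ - δ)).mul (hc (t₀ + δ))).continuousAt.eventually (gt_mem_nhds hsign)
  filter_upwards [hev, Metric.ball_mem_nhds a hε] with b hb hba
  have hcb : Continuous fun t : ℝ => f.eval₂ (eval b) t :=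
    (continuous_eval₂_eval f).comp (continuous_const.prodMk continuous_id)
  obtain ⟨t, ht, ht0⟩ := intermediate_value_uIcc (a := t₀ - δ) (b := t₀ + δ)
    hcb.continuousOn (show (0 : ℝ) ∈ _ by
      rw [Set.mem_uIcc]
      rcases mul_neg_iff.mp hb with h | h
      · exact Or.inr ⟨h.2.le, h.1.le⟩
      · exact Or.inl ⟨h.1.le, h.2.le⟩)
  refine ⟨t, hball ?_, ht0⟩
  rw [Set.uIcc_of_le (by linarith)] at ht
  rw [Metric.mem_ball, Prod.dist_eq]
  refine max_lt hba ?_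
  rw [Real.dist_eq, abs_lt]
  constructor <;> linarith [ht.1, ht.2]

/-- A small box is a product of infinite sets, and only the zero polynomial vanishes on such a
product. -/
theorem _root_.MvPolynomial.frequently_eval_ne_zero {h : MvPolynomial σ ℝ} (hh : h ≠ 0)
    (a : σ → ℝ) : ∃ᶠ b in 𝓝 a, eval b h ≠ 0 := by
  intro hev
  obtain ⟨ε, hε, H⟩ := Metric.eventually_nhds_iff.mp hev
  refine hh (MvPolynomial.funext_set (fun i => Metric.ball (a i) ε) (fun i => ?_) fun b hb => ?_)
  · rw [Real.ball_eq_Ioo]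
    exact Set.Ioo_infinite (by linarith)
  · rw [map_zero]
    exact not_not.mp (H ((dist_pi_lt_iff hε).mpr fun i => hb i (Set.mem_univ i)))

/-- Real points of a standard étale algebra over affine space that are close to a given one avoid
the zeros of any given nonzero polynomial on affine space. -/
theorem exists_ringHom_real_ne_zero (P : StandardEtalePair (MvPolynomial σ ℝ))
    (ψ₀ : P.Ring →+* ℝ) {c : P.Ring} (hc : ψ₀ c ≠ 0) {h : MvPolynomial σ ℝ} (hh : h ≠ 0) :
    ∃ ψ : P.Ring →+* ℝ, ψ c ≠ 0 ∧ ψ (algebraMap _ _ h) ≠ 0 := by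
  let S : StandardEtalePresentation (MvPolynomial σ ℝ) P.Ring :=
    ⟨P, P.X, P.hasMap_X, by simpa [P.lift_X_left] using Function.bijective_id⟩
  -- Clearing powers of the unit `g` turns `c ≠ 0` into the open condition `p ≠ 0` on pairs `(b,
  -- t)`.
  obtain ⟨p, n, hp⟩ : ∃ p : Polynomial (MvPolynomial σ ℝ), ∃ n,
    c * P.g.aeval P.X ^ n = p.aeval P.X := S.exists_mul_aeval_x_g_pow_eq_aeval_x c
  have key (ψ : P.Ring →+* ℝ) (a : σ → ℝ)
      (hψ : ψ.comp (algebraMap (MvPolynomial σ ℝ) P.Ring) = eval a)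
      (q : Polynomial (MvPolynomial σ ℝ)) : ψ (q.aeval P.X) = q.eval₂ (eval a) (ψ P.X) := by
    rw [Polynomial.aeval_def, Polynomial.hom_eval₂, hψ]
  have hψ₀ : ψ₀.comp (algebraMap (MvPolynomial σ ℝ) P.Ring) =
      eval fun i => ψ₀ (algebraMap _ _ (X i : MvPolynomial σ ℝ)) := by
    refine MvPolynomial.ringHom_ext (fun r => ?_) fun i => by simp
    rw [eval_C]
    -- The identity is the only ring endomorphism of `ℝ`.
    exact RingHom.congr_fun (Subsingleton.elim
      ((ψ₀.comp (algebraMap (MvPolynomial σ ℝ) P.Ring)).comp C) (RingHom.id ℝ)) r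
  set a : σ → ℝ := fun i => ψ₀ (algebraMap _ _ (X i : MvPolynomial σ ℝ))
  have hf0 := key ψ₀ a hψ₀ P.f
  rw [P.hasMap_X.1, map_zero] at hf0
  have hf1 := key ψ₀ a hψ₀ P.f.derivative
  have hf1' := (P.hasMap_X.isUnit_derivative_f.map ψ₀).ne_zero
  have hg := key ψ₀ a hψ₀ P.g
  have hg' := (P.hasMap_X.2.map ψ₀).ne_zero
  have hp0 := key ψ₀ a hψ₀ p
  have hp0' : ψ₀ (p.aeval P.X) ≠ 0 := by
    rw [← hp, map_mul, map_pow]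
    exact mul_ne_zero hc (pow_ne_zero _ hg')
  have hU : {x : (σ → ℝ) × ℝ | P.g.eval₂ (eval x.1) x.2 ≠ 0 ∧ p.eval₂ (eval x.1) x.2 ≠ 0} ∈
      𝓝 (a, ψ₀ P.X) :=
    ((continuous_eval₂_eval P.g).continuousAt.eventually_ne (hg ▸ hg')).and
      ((continuous_eval₂_eval p).continuousAt.eventually_ne (hp0 ▸ hp0'))
  obtain ⟨b, hb, t, ⟨htg, htp⟩, htf⟩ := ((MvPolynomial.frequently_eval_ne_zero hh a).and_eventually
    (eventually_exists_eval₂_eq_zero hf0.symm (hf1 ▸ hf1') hU)).exists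
  algebraize [eval b]
  have hmap : P.HasMap t := ⟨htf, htg.isUnit⟩
  have hψ : (P.lift t hmap : P.Ring →+* ℝ).comp (algebraMap (MvPolynomial σ ℝ) P.Ring) =
    eval b := RingHom.ext fun r => (P.lift t hmap).commutes r
  refine ⟨P.lift t hmap, fun h0 => htp ?_, ?_⟩
  · have h2 := key _ b hψ p
    rw [← hp, map_mul, h0, zero_mul] at h2
    rw [h2]
    simp
  · have := congr($hψ h)
    simp only [RingHom.comp_apply] at this
    rwa [this]

end StandardEtalePair

/-! ### Regular parameters as local coordinates -/

/-- Generators of the maximal ideal of a localization can be chosen in the ring itself. -/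
theorem exists_generators_of_localization_atPrime {A ι : Type*} [CommRing A] (m : Ideal A)
    [m.IsPrime] (s : ι → Localization.AtPrime m)
    (hs : maximalIdeal (Localization.AtPrime m) = Ideal.span (Set.range s)) :
    ∃ x : ι → A, (∀ i, x i ∈ m) ∧ maximalIdeal (Localization.AtPrime m) =
      Ideal.span (Set.range fun i => algebraMap A (Localization.AtPrime m) (x i)) := by
  have hex (i : ι) : ∃ a : A, ∃ u, IsUnit u ∧ algebraMap A (Localization.AtPrime m) a = u * s i := by
    obtain ⟨⟨a, b⟩, hab⟩ := IsLocalization.surj m.primeCompl (s i)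
    exact ⟨a, _, IsLocalization.map_units _ b, by rw [← hab, mul_comm]⟩
  choose x u hu hx using hex
  have hspan : maximalIdeal (Localization.AtPrime m) =
      Ideal.span (Set.range fun i => algebraMap A (Localization.AtPrime m) (x i)) := by
    rw [hs]
    apply le_antisymm <;> rw [Ideal.span_le] <;> rintro _ ⟨i, rfl⟩
    · refine (Ideal.unit_mul_mem_iff_mem _ (hu i)).mp ?_
      rw [← hx]
      exact Ideal.subset_span ⟨i, rfl⟩
    · simp only [hx]
      exact Ideal.mul_mem_left _ _ (Ideal.subset_span ⟨i, rfl⟩)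
  refine ⟨x, fun i => ?_, hspan⟩
  rw [← IsLocalization.AtPrime.to_map_mem_maximal_iff (Localization.AtPrime m) m, hspan]
  exact Ideal.subset_span ⟨i, rfl⟩

/-- At a rational point `m`, elements generating the maximal ideal of the local ring define an
unramified morphism to affine space. -/
theorem isUnramifiedAt_mvPolynomial_of_maximalIdeal_eq_span {k A σ : Type*} [Field k] [CharZero k]
    [CommRing A] [Algebra k A] [Algebra.FiniteType k A] [Finite σ]
    [Algebra (MvPolynomial σ k) A] [IsScalarTower k (MvPolynomial σ k) A]
    (m : Ideal A) [m.IsMaximal] (hm : Function.Surjective (algebraMap k (A ⧸ m)))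
    (hx : ∀ i, algebraMap (MvPolynomial σ k) A (.X i) ∈ m)
    (hspan : maximalIdeal (Localization.AtPrime m) = Ideal.span (Set.range fun i =>
      algebraMap A (Localization.AtPrime m) (algebraMap (MvPolynomial σ k) A (.X i)))) :
    Algebra.IsUnramifiedAt (MvPolynomial σ k) m := by
  have : Algebra.FiniteType (MvPolynomial σ k) A := .of_restrictScalars_finiteType k _ _
  let p : Ideal (MvPolynomial σ k) := m.under (MvPolynomial σ k)
  have : p.IsPrime := Ideal.IsPrime.under _ m
  let := Localization.AtPrime.algebraOfLiesOver p m
  rw [Algebra.isUnramifiedAt_iff_map_eq (MvPolynomial σ k) p m]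
  constructor
  · have hsurj : Function.Surjective (algebraMap p.ResidueField m.ResidueField) := by
      intro y
      obtain ⟨z, rfl⟩ := (Ideal.bijective_algebraMap_quotient_residueField m).surjective y
      obtain ⟨r, rfl⟩ := hm z
      refine ⟨algebraMap _ _ (MvPolynomial.C r : MvPolynomial σ k), ?_⟩
      rw [← IsScalarTower.algebraMap_apply, ← IsScalarTower.algebraMap_apply,
        ← MvPolynomial.algebraMap_eq, ← IsScalarTower.algebraMap_apply]
    have : Algebra.IsIntegral p.ResidueField m.ResidueField := ⟨fun y => by
      obtain ⟨z, rfl⟩ := hsurj y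
      exact isIntegral_algebraMap⟩
    have : CharZero p.ResidueField := algebraRat.charZero _
    infer_instance
  · apply le_antisymm
    · rw [Ideal.map_le_iff_le_comap]
      intro r hr
      rw [Ideal.mem_comap, IsScalarTower.algebraMap_apply (MvPolynomial σ k) A,
        IsLocalization.AtPrime.to_map_mem_maximal_iff (Localization.AtPrime m) m]
      exact hr
    · rw [hspan, Ideal.span_le]
      rintro _ ⟨i, rfl⟩
      simp only [SetLike.mem_coe]
      rw [← IsScalarTower.algebraMap_apply]
      exact Ideal.mem_map_of_mem _ (hx i)

/-- The ideal of the origin of affine space is generated by the coordinates. -/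
theorem MvPolynomial.ker_constantCoeff_le_span_range_X {σ R : Type*} [CommRing R] :
    RingHom.ker (constantCoeff : MvPolynomial σ R →+* R) ≤ Ideal.span (Set.range X) := by
  intro p hp
  rw [← Set.image_univ, MvPolynomial.mem_ideal_span_X_image]
  intro d hd
  by_contra! hcon
  have : d = 0 := Finsupp.ext fun i => hcon i (Set.mem_univ i)
  subst this
  exact (mem_support_iff.mp hd) hp

/-- The maximal ideal of an algebra unramified over affine space at a point lying above the
origin is generated by the coordinates. -/
theorem maximalIdeal_eq_span_of_isUnramifiedAt {σ k B : Type*} [Field k] [CommRing B] [Finite σ]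
    [Algebra (MvPolynomial σ k) B] [Algebra.EssFiniteType (MvPolynomial σ k) B] (n : Ideal B)
    [n.IsPrime] [Algebra.IsUnramifiedAt (MvPolynomial σ k) n]
    (hn : n.under (MvPolynomial σ k) ≤ RingHom.ker MvPolynomial.constantCoeff)
    (hX : ∀ i, algebraMap (MvPolynomial σ k) B (.X i) ∈ n) :
    maximalIdeal (Localization.AtPrime n) = Ideal.span (Set.range fun i =>
      algebraMap (MvPolynomial σ k) (Localization.AtPrime n) (.X i)) := by
  let p : Ideal (MvPolynomial σ k) := n.under (MvPolynomial σ k)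
  have : p.IsPrime := Ideal.IsPrime.under _ n
  let := Localization.AtPrime.algebraOfLiesOver p n
  rw [← ((Algebra.isUnramifiedAt_iff_map_eq (MvPolynomial σ k) p n).mp inferInstance).2]
  have hp : p = Ideal.span (Set.range MvPolynomial.X) := by
    apply le_antisymm (hn.trans MvPolynomial.ker_constantCoeff_le_span_range_X)
    rw [Ideal.span_le]
    rintro _ ⟨i, rfl⟩
    exact hX i
  rw [hp, Ideal.map_span, ← Set.range_comp]
  rfl

/-- Let `B` be a Noetherian ring with a map `τ` to a local ring `L`, and `n` the preimage of the
maximal ideal. If `L` is a localization of the image of `τ`, and the maximal ideal of `B_n` is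
generated by at most `dim L` elements, then `B_n` is a domain which injects into `L`. -/
theorem localization_isDomain_and_injective {d : ℕ} {B L : Type*} [CommRing B] [IsNoetherianRing B]
    [CommRing L] [IsLocalRing L] (τ : B →+* L) (n : Ideal B) [n.IsPrime]
    (hn : ∀ y : n.primeCompl, IsUnit (τ y))
    (hτ : ∀ z : L, ∃ b, ∃ c ∉ n, z * τ c = τ b) (s : Fin d → Localization.AtPrime n)
    (hs : maximalIdeal (Localization.AtPrime n) = Ideal.span (Set.range s))
    (hd : (d : WithBot ℕ∞) ≤ ringKrullDim L) :
    IsDomain (Localization.AtPrime n) ∧ ∀ b, τ b = 0 → ∃ c ∉ n, c * b = 0 := by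
  let θ : Localization.AtPrime n →+* L := IsLocalization.lift hn
  have hθ (b : B) : θ (algebraMap B _ b) = τ b := IsLocalization.lift_eq hn b
  have hsurj : Function.Surjective θ := by
    intro z
    obtain ⟨b, c, hc, h⟩ := hτ z
    refine ⟨IsLocalization.mk' _ b (⟨c, hc⟩ : n.primeCompl), ?_⟩
    rw [IsLocalization.lift_mk'_spec, ← h, mul_comm]
  have hdim := hd.trans (ringKrullDim_le_of_surjective θ hsurj)
  have hdom := isDomain_of_maximalIdeal_eq_span s hs hdim
  refine ⟨hdom, fun b hb => ?_⟩
  have h0 : algebraMap B (Localization.AtPrime n) b = 0 := by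
    by_contra h0
    -- A nonzero kernel element would force dimension at least `d + 1`, but `d` generators bound it
    -- by `d`.
    have h1 := ringKrullDim_succ_le_of_surjective θ hsurj
      (mem_nonZeroDivisors_of_ne_zero h0) (by rw [hθ, hb])
    have h2 : ringKrullDim (Localization.AtPrime n) ≤ d := by
      refine (ringKrullDim_le_spanFinrank_maximalIdeal _).trans ?_
      rw [hs]
      have := Submodule.spanFinrank_span_le_ncard_of_finite (R := Localization.AtPrime n)
        (Set.finite_range s)
      have h3 : (Set.range s).ncard ≤ d := by
        rw [← Set.image_univ]
        exact (Set.ncard_image_le Set.finite_univ).trans (by simp [Set.ncard_univ])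
      exact_mod_cast this.trans h3
    have h3 : (d : WithBot ℕ∞) + 1 ≤ d := (add_le_add_left hd 1).trans (h1.trans h2)
    exact absurd h3 (by exact_mod_cast (Nat.lt_succ_self d).not_ge)
  obtain ⟨⟨c, hc⟩, h⟩ := (IsLocalization.map_eq_zero_iff n.primeCompl _ _).mp h0
  exact ⟨c, hc, h⟩

/-- In a localization of a standard étale algebra which is a domain, every nonzero element divides
a nonzero element of the base ring. -/
theorem StandardEtalePair.exists_dvd_algebraMap {R : Type*} [CommRing R] (P : StandardEtalePair R)
    (n : Ideal P.Ring) [n.IsPrime] [IsDomain (Localization.AtPrime n)] {b : P.Ring}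
    (hb : algebraMap P.Ring (Localization.AtPrime n) b ≠ 0) :
    ∃ h : R, h ≠ 0 ∧ ∃ c ∉ n, b ∣ c * algebraMap R P.Ring h := by
  let S := Localization.AtPrime n
  let E : StandardEtalePresentation R P.Ring :=
    ⟨P, P.X, P.hasMap_X, by simpa [P.lift_X_left] using Function.bijective_id⟩
  obtain ⟨p, k, hp⟩ : ∃ p : Polynomial R, ∃ k,
    b * P.g.aeval P.X ^ k = p.aeval P.X := E.exists_mul_aeval_x_g_pow_eq_aeval_x b
  have hX : IsIntegral R P.X := ⟨P.f, P.monic_f, P.hasMap_X.1⟩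
  have hint : IsIntegral R (p.aeval P.X) := IsIntegral.of_mem_of_fg _ hX.fg_adjoin_singleton _
    (Polynomial.aeval_mem_adjoin_singleton _ _)
  let R' := (algebraMap R S).range
  have hint' : IsIntegral R' (algebraMap P.Ring S (p.aeval P.X)) := by
    have h1 : IsIntegral R (algebraMap P.Ring S (p.aeval P.X)) := hint.algebraMap
    obtain ⟨q, hq, hq0⟩ := h1
    refine ⟨q.map (algebraMap R S).rangeRestrict, hq.map _, ?_⟩
    rw [Polynomial.eval₂_map]
    exact hq0
  have hne : algebraMap P.Ring S (p.aeval P.X) ≠ 0 := by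
    rw [← hp, map_mul, map_pow]
    exact mul_ne_zero hb (pow_ne_zero _ (P.hasMap_X.2.map _).ne_zero)
  have hmem : algebraMap P.Ring S (p.aeval P.X) ∈ Ideal.span {algebraMap P.Ring S b} := by
    rw [← hp, map_mul]
    exact Ideal.mul_mem_right _ _ (Ideal.mem_span_singleton_self _)
  -- In a domain, a nonzero integral element divides the nonzero constant term of an integral
  -- equation of least degree.
  obtain ⟨⟨_, h, rfl⟩, hr, hr0⟩ := Submodule.exists_mem_ne_zero_of_ne_bot
    (Ideal.comap_ne_bot_of_integral_mem hne hmem hint')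
  refine ⟨h, by rintro rfl; exact hr0 (Subtype.ext (map_zero _)), ?_⟩
  obtain ⟨z, hz⟩ := Ideal.mem_span_singleton'.mp (Ideal.mem_comap.mp hr)
  replace hz : z * algebraMap P.Ring S b = algebraMap R S h := hz
  obtain ⟨⟨u, c⟩, hu⟩ := IsLocalization.surj n.primeCompl z
  have heq : algebraMap P.Ring S (u * b) = algebraMap P.Ring S (c * algebraMap R P.Ring h) := by
    rw [map_mul, map_mul, ← IsScalarTower.algebraMap_apply, ← hz, ← hu]
    ring
  obtain ⟨e, he⟩ := (IsLocalization.eq_iff_exists n.primeCompl S).mp heq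
  exact ⟨e * c, n.primeCompl.mul_mem e.2 c.2, e * u, by rw [mul_assoc, ← he]; ring⟩

/-! ### Real points near a rational point, and density -/

/-- If `f` does not vanish identically near a rational point of a regular real affine scheme, then
it does not vanish at some rational point. -/
theorem exists_algHom_real_ne_zero {A : Type*} [CommRing A] [Algebra ℝ A] [Algebra.FiniteType ℝ A]
    (φ₀ : A →ₐ[ℝ] ℝ) {m : Ideal A} [m.IsPrime] (hm : RingHom.ker φ₀ = m)
    [IsRegularLocalRing (Localization.AtPrime m)] {f : A}
    (hf : algebraMap A (Localization.AtPrime m) f ≠ 0) :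
    ∃ φ : A →ₐ[ℝ] ℝ, φ f ≠ 0 := by
  let L := Localization.AtPrime m
  have hφ₀ : Function.Surjective φ₀ := fun r => ⟨algebraMap ℝ A r, by simp⟩
  have : m.IsMaximal := hm ▸ RingHom.ker_isMaximal_of_surjective _ hφ₀
  obtain ⟨d, s, hs, hd⟩ := IsRegularLocalRing.exists_maximalIdeal_eq_span L
  obtain ⟨x, hxm, hspan⟩ := exists_generators_of_localization_atPrime m s hs
  let R := MvPolynomial (Fin d) ℝ
  algebraize [(MvPolynomial.aeval x : R →ₐ[ℝ] A).toRingHom]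
  have : IsScalarTower ℝ R A :=
    .of_algebraMap_eq fun r => ((MvPolynomial.aeval x : R →ₐ[ℝ] A).commutes r).symm
  have hX (i : Fin d) : algebraMap R A (.X i) = x i := MvPolynomial.aeval_X x i
  have : Algebra.FiniteType R A := .of_restrictScalars_finiteType ℝ _ _
  have : Algebra.IsUnramifiedAt R m := by
    refine isUnramifiedAt_mvPolynomial_of_maximalIdeal_eq_span m (fun y => ?_)
      (fun i => hX i ▸ hxm i) 
      (hspan.trans (congr_arg Ideal.span (congr_arg Set.range
        (funext fun i => congr_arg _ (hX i).symm))))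
    obtain ⟨a, rfl⟩ := Ideal.Quotient.mk_surjective y
    refine ⟨φ₀ a, (Ideal.Quotient.eq (I := m)).mpr ?_⟩
    simp [← hm, RingHom.mem_ker]
  obtain ⟨g, hg, P, π, hπ⟩ := Algebra.IsUnramifiedAt.exists_hasStandardEtaleSurjectionOn (R := R) m
  have hgL : IsUnit (algebraMap A L g) := IsLocalization.map_units L (⟨g, hg⟩ : m.primeCompl)
  let ρ : Localization.Away g →+* L := IsLocalization.Away.lift g hgL
  have hρ (a : A) : ρ (algebraMap A _ a) = algebraMap A L a := IsLocalization.Away.lift_eq g hgL a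
  let τ : P.Ring →+* L := ρ.comp π
  let n : Ideal P.Ring := (maximalIdeal L).comap τ
  have hker : ∀ y, y ∈ m ↔ φ₀ y = 0 := fun y => hm ▸ RingHom.mem_ker
  -- Evaluation at the rational point; `θ.comp τ` is the corresponding real point of `P.Ring`.
  let θ : L →+* ℝ := IsLocalization.lift (M := m.primeCompl) (g := (φ₀ : A →+* ℝ))
    fun y => isUnit_iff_ne_zero.mpr ((hker y).not.mp y.2)
  have hθ (a : A) : θ (algebraMap A L a) = φ₀ a := IsLocalization.lift_eq _ a
  have hθn (c : P.Ring) (hc : c ∉ n) : (θ.comp τ) c ≠ 0 := by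
    have : IsUnit (τ c) := not_not.mp fun h => hc ((mem_maximalIdeal _).mpr h)
    exact (this.map θ).ne_zero
  have hτR (r : R) : τ (algebraMap R P.Ring r) = algebraMap A L (algebraMap R A r) := by
    rw [RingHom.comp_apply, RingHom.coe_coe, π.commutes, IsScalarTower.algebraMap_apply R A, hρ]
  have : IsNoetherianRing P.Ring := Algebra.FiniteType.isNoetherianRing R P.Ring
  have hspan' := maximalIdeal_eq_span_of_isUnramifiedAt (k := ℝ) (σ := Fin d) n (by
    intro r hr
    have h1 : θ (τ (algebraMap R P.Ring r)) = 0 := by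
      by_contra h0
      refine (mem_maximalIdeal _).mp (Ideal.mem_comap.mp (Ideal.mem_comap.mp hr)) ?_
      rw [hτR] at h0 ⊢
      rw [hθ] at h0
      exact IsLocalization.map_units L (⟨_, (hker _).not.mpr h0⟩ : m.primeCompl)
    rw [hτR, hθ] at h1
    have h2 : (φ₀ : A →+* ℝ).comp (algebraMap R A) = MvPolynomial.constantCoeff := by
      refine MvPolynomial.ringHom_ext (fun r => ?_) fun i => ?_
      · rw [← MvPolynomial.algebraMap_eq, RingHom.comp_apply, ← IsScalarTower.algebraMap_apply]
        simp [MvPolynomial.algebraMap_eq]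
      · rw [RingHom.comp_apply, hX, MvPolynomial.constantCoeff_X]
        exact (hker _).mp (hxm i)
    rw [RingHom.mem_ker, ← h2]
    exact h1) (by
    intro i
    rw [Ideal.mem_comap, hτR, hX, IsLocalization.AtPrime.to_map_mem_maximal_iff L m]
    exact hxm i)
  obtain ⟨hdom, hinj⟩ := localization_isDomain_and_injective τ n
    (fun y => not_not.mp fun h => y.2 ((mem_maximalIdeal _).mpr h)) (by
      intro z
      obtain ⟨⟨a, b⟩, hab⟩ := IsLocalization.surj m.primeCompl z
      obtain ⟨a', ha'⟩ := hπ (algebraMap A _ a)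
      obtain ⟨b', hb'⟩ := hπ (algebraMap A _ b)
      have hτa : τ a' = algebraMap A L a := by rw [← hρ, ← ha']; rfl
      have hτb : τ b' = algebraMap A L b := by rw [← hρ, ← hb']; rfl
      refine ⟨a', b', fun h => ?_, by rw [hτa, hτb]; exact hab⟩
      rw [Ideal.mem_comap, hτb, IsLocalization.AtPrime.to_map_mem_maximal_iff L m] at h
      exact b.2 h) _ hspan' hd.le
  -- Since `c₁` kills `ker π`, every real point of `P.Ring` with `c₁ ≠ 0` factors through `π`.
  obtain ⟨c₁, hc₁, hc₁π⟩ := Ideal.FG.exists_notMem_forall_mul_eq_zero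
    (I := RingHom.ker (π : P.Ring →+* Localization.Away g)) (IsNoetherian.noetherian _) (p := n) inferInstance
    fun z hz => hinj z (by rw [RingHom.comp_apply, RingHom.mem_ker.mp hz, map_zero])
  obtain ⟨f', hf'⟩ := hπ (algebraMap A _ f)
  obtain ⟨h, hh, c₂, hc₂, hdvd⟩ := P.exists_dvd_algebraMap n (b := f') (by
    intro h0
    obtain ⟨⟨c, hc⟩, h⟩ := (IsLocalization.map_eq_zero_iff n.primeCompl _ _).mp h0
    have h1 : τ f' = 0 := by
      have hu : IsUnit (τ c) := not_not.mp fun h => hc ((mem_maximalIdeal _).mpr h)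
      rw [← hu.mul_right_eq_zero, ← map_mul, h, map_zero]
    rw [RingHom.comp_apply, RingHom.coe_coe, hf', hρ] at h1
    exact hf h1)
  obtain ⟨ψ, hψ, hψh⟩ := P.exists_ringHom_real_ne_zero (θ.comp τ) (c := c₁ * c₂)
    (by rw [map_mul]; exact mul_ne_zero (hθn _ hc₁) (hθn _ hc₂)) hh
  rw [map_mul] at hψ
  have hψπ : RingHom.ker (π : P.Ring →+* Localization.Away g) ≤ RingHom.ker ψ := fun z hz =>
    (mul_eq_zero.mp (by rw [← map_mul, hc₁π z hz, map_zero])).resolve_left (left_ne_zero_of_mul hψ)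
  let χ : Localization.Away g →+* ℝ :=
    (π : P.Ring →+* Localization.Away g).liftOfSurjective hπ ⟨ψ, hψπ⟩
  have hχ (z : P.Ring) : χ (π z) = ψ z :=
    (π : P.Ring →+* Localization.Away g).liftOfRightInverse_comp_apply _ _ ⟨ψ, hψπ⟩ z
  let φ : A →+* ℝ := χ.comp (algebraMap A _)
  refine ⟨⟨φ, fun r => ?_⟩, fun h0 => ?_⟩
  · exact RingHom.congr_fun (Subsingleton.elim (φ.comp (algebraMap ℝ A)) (RingHom.id ℝ)) r
  · have h1 : ψ f' = 0 := by rw [← hχ, hf']; exact h0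
    obtain ⟨u, hu⟩ := hdvd
    have h2 := congr_arg ψ hu
    rw [map_mul, map_mul, h1, zero_mul] at h2
    exact mul_ne_zero (right_ne_zero_of_mul hψ) hψh h2

/-- On a regular ring, a function which does not vanish at a point has a nonzero germ at every
point of the connected component of that point. -/
theorem IsRegularRing.algebraMap_localization_ne_zero {A : Type*} [CommRing A] [IsRegularRing A]
    {x y : PrimeSpectrum A} (hy : y ∈ connectedComponent x) {f : A} (hx : f ∉ x.asIdeal) :
    algebraMap A (Localization.AtPrime y.asIdeal) f ≠ 0 := by
  intro h0
  have hsub := (isClopen_setOf_algebraMap_eq_zero f).connectedComponent_subset h0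
  -- The clopen set contains the component of `y`, hence `x`, where `f` is a unit.
  rw [← connectedComponent_eq hy] at hsub
  obtain ⟨⟨b, hb⟩, h⟩ := (IsLocalization.map_eq_zero_iff x.asIdeal.primeCompl _ _).mp
    (hsub mem_connectedComponent)
  exact x.isPrime.mul_notMem hb hx (h ▸ x.asIdeal.zero_mem)

theorem mainTheorem2 (A : Type*) [CommRing A] [Algebra ℝ A] [Algebra.FiniteType ℝ A]
    [IsRegularRing A] (hA : NoImaginaryComponents A) :
    Dense (rationalPoints ℝ A) := by
  rw [PrimeSpectrum.isBasis_basic_opens.dense_iff]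
  rintro _ ⟨_, ⟨f, rfl⟩, rfl⟩ ⟨x, hx⟩
  obtain ⟨y, hy, φ₀, hφ₀⟩ := hA x
  obtain ⟨φ, hφ⟩ := exists_algHom_real_ne_zero φ₀ (congr_arg PrimeSpectrum.asIdeal hφ₀)
    (IsRegularRing.algebraMap_localization_ne_zero hy hx)
  exact ⟨_, hφ, φ, rfl⟩
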